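/- There is an absolute constant $C_0>0$ such that the following holds. Let $k\ge 2$, $k\le r$, $1\le p\le r$ and $n$ be integers, let $C_1^*,\dots,C_k^*$ be a partition of $[n]$ into $k$ (possibly empty) communities, let $B\in[0,1]^{k\times k}$ be symmetric, and let $\theta_1,\dots,\theta_n\ge 0$ be such that $B_{ab}\theta_i\theta_j\le 1$ for all $i\in C_a^*$, $j\in C_b^*$ (including $i=j$). Let $A\in\{0,1\}^{n\times n}$ be the adjacency matrix of a random graph from the degree-corrected stochastic block model: $A$ is symmetric with zero diagonal, the entries $A_{ij}$, $i<j$, are independent, and $A_{ij}=1$ with probability $B_{ab}\theta_i\theta_j$ and $A_{ij}=0$ otherwise, for $i\in C_a^*$, $j\in C_b^*$, $i\ne j$. Put $$G_a=\sum_{i\in C_a^*}\theta_i,\qquad H_a=\sum_{b=1}^k B_{ab}G_b,\qquad f_i=H_a\theta_i\ \ (i\in C_a^*),\qquad \|f\|_1=\sum_i|f_i|,$$ and assume that all $H_a$ are nonzero and that the density gap condition $$\max_{1\le a<b\le k}\frac{B_{ab}}{H_aH_b}<\min_{1\le a\le k}\frac{B_{aa}}{H_a^2}$$ holds. Let $\lambda\in\mathbb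 R$ and $\delta>0$ satisfy $$\max_{1\le a<b\le k}\frac{B_{ab}+\delta}{H_aH_b}<\lambda<\min_{1\le a\le k}\frac{B_{aa}-\delta}{H_a^2}.$$ Let $d_i=\sum_jA_{ij}$ and $C=-(A-\lambda dd^{\top})$, and consider the sparse completely positive relaxation $$\min_{U\in\mathbb R^{n\times r}}\ \langle C,UU^{\top}\rangle\quad\text{s.t.}\quad \|u_i\|_2=1,\ \ \|u_i\|_0\le p\ \ (i=1,\dots,n),\ \ U\ge 0,$$ where $u_i$ is the $i$-th row of $U$ and $\|u_i\|_0$ is the number of its nonzero entries. Let $\Phi^*\in\{0,1\}^{n\times r}$ be the true assignment matrix: $\Phi^*_{ia}=1$ if and only if $a\le k$ and $i\in C_a^*$. Write $\|X\|_{1,\theta}=\sum_{i,j}|X_{ij}|\theta_i\theta_j$. Then with probability at least $0.99-2(e/2)^{-2n}$, every global optimal solution $U^*$ of the relaxation satisfies $$\|U^*(U^*)^{\top}-\Phi^*(\Phi^*)^{\top}\|_{1,\theta}\le\frac{C_0}{\delta}\left(1+\max_{1\le a\le k}\frac{B_{aa}}{H_a^2}\|f\|_1\right)\left(\sqrt{n\|f\|_1}+n\right).$$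 -/

import Mathlib

open MeasureTheory ProbabilityTheory

/-- Parameters of a degree-corrected stochastic block model on `n` nodes with `k` communities.
The communities are the fibres of `label`. All the numbers `B_{ab} θ_i θ_j`
(`i` in community `a`, `j` in community `b`, `i = j` included) are at most one. -/
structure DCSBM (n k : ℕ) where
  /-- the community of each node -/
  label : Fin n → Fin k
  /-- the connection matrix -/
  B : Matrix (Fin k) (Fin k) ℝ
  /-- the degree heterogeneity parameters -/
  θ : Fin n → ℝ
  B_symm : B.IsSymm
  B_nonneg : ∀ a b, 0 ≤ B a b
  B_le_one : ∀ a b, B a b ≤ 1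
  θ_nonneg : ∀ i, 0 ≤ θ i
  prob_le_one : ∀ i j, B (label i) (label j) * θ i * θ j ≤ 1

namespace DCSBM

variable {n k : ℕ} (M : DCSBM n k)

/-- `G_a = ∑_{i ∈ C_a} θ_i` -/
def G (a : Fin k) : ℝ := ∑ i with M.label i = a, M.θ i

/-- `H_a = ∑_b B_{ab} G_b` -/
def H (a : Fin k) : ℝ := ∑ b, M.B a b * M.G b

/-- `f_i = H_a θ_i` for `i ∈ C_a` -/
def f (i : Fin n) : ℝ := M.H (M.label i) * M.θ i

/-- `‖f‖₁` -/
def fNorm : ℝ := ∑ i, |M.f i|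

/-- The density gap condition
`max_{a < b} B_{ab} / (H_a H_b) < min_c B_{cc} / H_c ^ 2`. -/
def DensityGap : Prop :=
  ∀ a b c : Fin k, a < b → M.B a b / (M.H a * M.H b) < M.B c c / M.H c ^ 2

/-- `max_{a < b} (B_{ab} + δ) / (H_a H_b) < lam < min_a (B_{aa} - δ) / H_a ^ 2`. -/
def InGap (lam δ : ℝ) : Prop :=
  (∀ a b : Fin k, a < b → (M.B a b + δ) / (M.H a * M.H b) < lam) ∧
    ∀ a : Fin k, lam < (M.B a a - δ) / M.H a ^ 2

/-- The true assignment matrix, with `r` columns (the columns beyond the `k`-th are zero). -/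
def assignment (r : ℕ) : Matrix (Fin n) (Fin r) ℝ :=
  Matrix.of fun i l => if (M.label i : ℕ) = (l : ℕ) then 1 else 0

/-- The weighted norm `‖X‖_{1,θ} = ∑_{i,j} |X_{ij}| θ_i θ_j`. -/
def weightedNorm (X : Matrix (Fin n) (Fin n) ℝ) : ℝ :=
  ∑ i, ∑ j, |X i j| * M.θ i * M.θ j

/-- `A` is the adjacency matrix of a random graph drawn from the model: it is symmetric with
entries in `{0, 1}` and zero diagonal, and the entries above the diagonal are independent,
the `(i, j)` entry being one with probability `B_{ab} θ_i θ_j` for `i ∈ C_a`, `j ∈ C_b`. -/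
structure IsAdjacency {Ω : Type*} [MeasurableSpace Ω] (μ : Measure Ω)
    (A : Ω → Matrix (Fin n) (Fin n) ℝ) : Prop where
  measurable : ∀ i j, Measurable fun ω => A ω i j
  zero_or_one : ∀ ω i j, A ω i j = 0 ∨ A ω i j = 1
  symm : ∀ ω, (A ω).IsSymm
  diag : ∀ ω i, A ω i i = 0
  prob_one : ∀ i j, i ≠ j →
    μ.real {ω | A ω i j = 1} = M.B (M.label i) (M.label j) * M.θ i * M.θ j
  prob_zero : ∀ i j, i ≠ j →
    μ.real {ω | A ω i j = 0} = 1 - M.B (M.label i) (M.label j) * M.θ i * M.θ j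
  indep : iIndepFun (fun (e : {e : Fin n × Fin n // e.1 < e.2}) (ω : Ω) => A ω e.1.1 e.1.2) μ

end DCSBM

/-- The degree vector `d_i = ∑_j A_{ij}`. -/
def degreeVec {n : ℕ} (A : Matrix (Fin n) (Fin n) ℝ) (i : Fin n) : ℝ := ∑ j, A i j

/-- The matrix `C = -(A - lam d dᵀ)`. -/
def costMatrix {n : ℕ} (A : Matrix (Fin n) (Fin n) ℝ) (lam : ℝ) : Matrix (Fin n) (Fin n) ℝ :=
  -(A - lam • Matrix.vecMulVec (degreeVec A) (degreeVec A))

/-- The objective `⟨C, U Uᵀ⟩`. -/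
def cpObjective {n r : ℕ} (A : Matrix (Fin n) (Fin n) ℝ) (lam : ℝ)
    (U : Matrix (Fin n) (Fin r) ℝ) : ℝ :=
  ∑ i, ∑ j, costMatrix A lam i j * (U * U.transpose) i j

/-- The feasible set of the sparse completely positive relaxation: entrywise nonnegative matrices
whose rows have Euclidean norm one and at most `p` nonzero entries. -/
def cpFeasible (n r p : ℕ) : Set (Matrix (Fin n) (Fin r) ℝ) :=
  {U | (∀ i, ∑ l, U i l ^ 2 = 1) ∧ (∀ i, {l | U i l ≠ 0}.ncard ≤ p) ∧ ∀ i l, 0 ≤ U i l}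

/-- `U` is a global optimal solution of the sparse completely positive relaxation. -/
def IsCPOptimal {n r : ℕ} (A : Matrix (Fin n) (Fin n) ℝ) (lam : ℝ) (p : ℕ)
    (U : Matrix (Fin n) (Fin r) ℝ) : Prop :=
  U ∈ cpFeasible n r p ∧ IsMinOn (cpObjective A lam) (cpFeasible n r p) U

/-! Write `P` for the matrix `M.prob`, whose row sums are `f`, and `D = U Uᵀ - Φ Φᵀ` for the error.
The gap condition makes the population cost `-(P - lam f fᵀ)` at most `-δ θ_i θ_j` inside
communities and at least `δ θ_i θ_j` across them. Entries of `U Uᵀ` lie in `[0, 1]`, so `D` has the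
matching signs and its pairing with this cost is at least `δ ‖D‖_{1,θ}` (`InGap.mul_abs_le`).

Optimality of `U` against the feasible truth makes the pairing of `D` with the empirical cost
nonpositive, so only the difference of the two costs must be controlled. If `N` bounds the bilinear
form of `A - P` on sign vectors, Grothendieck's inequality (`isVectorBound_of_signs`) bounds the
contributions of `U Uᵀ` and `Φ Φᵀ` by `98 N` each. Also `‖d - f‖₁ ≤ N`, so with total degree at most
`100 ‖f‖₁` the rank-one difference `d dᵀ - f fᵀ` costs at most `101 ‖f‖₁ N`.

A Chernoff bound and a union over the `4 ^ n` pairs of sign vectors give `N = 9 (√(n ‖f‖₁) + n)`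
(`measure_exists_signs_le`); Markov's inequality controls the total degree. -/

/-! ### Rademacher sums and Grothendieck's inequality -/

/-- The sign `±1` encoded by a Boolean. -/
def boolSign (b : Bool) : ℝ := if b then 1 else -1

/-- The Rademacher sum `∑ l, ε_l u_l`. -/
def signSum {m : ℕ} (u : Fin m → ℝ) (ω : Fin m → Bool) : ℝ := ∑ l, boolSign (ω l) * u l

theorem sum_bool_cons {m : ℕ} (F : (Fin (m + 1) → Bool) → ℝ) :
    ∑ ω, F ω = ∑ ω : Fin m → Bool, (F (Fin.cons true ω) + F (Fin.cons false ω)) := by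
  rw [← (Fin.consEquiv (fun _ : Fin (m + 1) => Bool)).sum_comp, Fintype.sum_prod_type,
    Fintype.sum_bool, ← Finset.sum_add_distrib]
  rfl

theorem signSum_cons {m : ℕ} (u : Fin (m + 1) → ℝ) (b : Bool) (ω : Fin m → Bool) :
    signSum u (Fin.cons b ω) = boolSign b * u 0 + signSum (Fin.tail u) ω := by
  simp [signSum, Fin.sum_univ_succ, Fin.tail]

theorem sum_signSum_mul {m : ℕ} (u v : Fin m → ℝ) :
    ∑ ω, signSum u ω * signSum v ω = 2 ^ m * ∑ l, u l * v l := by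
  induction m with
  | zero => simp [signSum]
  | succ m ih =>
    rw [sum_bool_cons, Fin.sum_univ_succ]
    have h : ∀ ω : Fin m → Bool,
        signSum u (Fin.cons true ω) * signSum v (Fin.cons true ω) +
          signSum u (Fin.cons false ω) * signSum v (Fin.cons false ω) =
        2 * (u 0 * v 0) + 2 * (signSum (Fin.tail u) ω * signSum (Fin.tail v) ω) := by
      intro ω
      simp only [signSum_cons, boolSign]
      norm_num
      ring
    simp only [h, Finset.sum_add_distrib, ← Finset.mul_sum, ih]
    simp [Fin.tail]
    ring

/-- Averaging over the first sign kills the odd powers of `u 0`; the surviving cross term is a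
second moment, and the tail is handled by induction. -/
theorem sum_signSum_pow_four_le {m : ℕ} (u : Fin m → ℝ) :
    ∑ ω, signSum u ω ^ 4 ≤ 3 * 2 ^ m * (∑ l, u l ^ 2) ^ 2 := by
  induction m with
  | zero => simp [signSum]
  | succ m ih =>
    rw [sum_bool_cons, Fin.sum_univ_succ]
    have h : ∀ ω : Fin m → Bool,
        signSum u (Fin.cons true ω) ^ 4 + signSum u (Fin.cons false ω) ^ 4 =
        2 * u 0 ^ 4 + 12 * u 0 ^ 2 * (signSum (Fin.tail u) ω * signSum (Fin.tail u) ω)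
          + 2 * signSum (Fin.tail u) ω ^ 4 := by
      intro ω
      simp only [signSum_cons, boolSign]
      norm_num
      ring
    simp only [h, Finset.sum_add_distrib, ← Finset.mul_sum, sum_signSum_mul]
    have hs := ih (Fin.tail u)
    have e : ∑ l, Fin.tail u l * Fin.tail u l = ∑ l : Fin m, u l.succ ^ 2 := by
      simp [Fin.tail, sq]
    have e' : ∑ l, Fin.tail u l ^ 2 = ∑ l : Fin m, u l.succ ^ 2 := by simp [Fin.tail]
    rw [e'] at hs
    rw [e]
    set s := ∑ l : Fin m, u l.succ ^ 2
    have hc : ∑ _ω : Fin m → Bool, 2 * u 0 ^ 4 = 2 ^ m * (2 * u 0 ^ 4) := by simp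
    have h4 : 0 ≤ (2 : ℝ) ^ m * u 0 ^ 4 := by positivity
    rw [pow_succ (2 : ℝ) m]
    simp only [Finset.sum_const, Finset.card_univ, Fintype.card_pi, Fintype.card_bool,
      Finset.prod_const, Fintype.card_fin, nsmul_eq_mul, Nat.cast_pow, Nat.cast_ofNat]
    nlinarith

/-- A bilinear form on `[-1, 1]`-vectors is bounded by its maximum over sign vectors. -/
theorem bilin_le_of_signs {κ : Type*} [Fintype κ] {E : κ → κ → ℝ} {N : ℝ}
    (hN : ∀ x y : κ → Bool, ∑ i, ∑ j, E i j * boolSign (x i) * boolSign (y j) ≤ N)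
    {x y : κ → ℝ} (hx : ∀ i, |x i| ≤ 1) (hy : ∀ i, |y i| ≤ 1) :
    ∑ i, ∑ j, E i j * x i * y j ≤ N := by
  have key : ∀ (a z : κ → ℝ), (∀ i, |z i| ≤ 1) →
      ∑ i, a i * z i ≤ ∑ i, a i * boolSign (decide (0 ≤ a i)) := by
    intro a z hz
    refine Finset.sum_le_sum fun i _ => ?_
    have := abs_le.1 (hz i)
    by_cases h : 0 ≤ a i
    · simp only [boolSign, h, decide_true, if_true]; nlinarith
    · simp only [boolSign, h, decide_false]; norm_num; nlinarith
  calc ∑ i, ∑ j, E i j * x i * y j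
      = ∑ i, (∑ j, E i j * y j) * x i := by
        refine Finset.sum_congr rfl fun i _ => ?_
        rw [Finset.sum_mul]
        exact Finset.sum_congr rfl fun j _ => by ring
    _ ≤ ∑ i, (∑ j, E i j * y j) * boolSign (decide (0 ≤ ∑ j, E i j * y j)) := key _ _ hx
    _ = ∑ j, (∑ i, E i j * boolSign (decide (0 ≤ ∑ j, E i j * y j))) * y j := by
        simp only [Finset.sum_mul]
        rw [Finset.sum_comm]
        exact Finset.sum_congr rfl fun j _ => Finset.sum_congr rfl fun i _ => by ring
    _ ≤ _ := key _ _ hy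
    _ = _ := by
        simp only [Finset.sum_mul]
        exact Finset.sum_comm
    _ ≤ N := hN _ _

/-- `K` bounds the form `E` on pairs of families of vectors in finite-dimensional unit balls. -/
def IsVectorBound {κ : Type*} [Fintype κ] (E : κ → κ → ℝ) (K : ℝ) : Prop :=
  ∀ (m : ℕ) (u v : κ → Fin m → ℝ), (∀ i, ∑ l, u i l ^ 2 ≤ 1) → (∀ i, ∑ l, v i l ^ 2 ≤ 1) →
    ∑ i, ∑ j, E i j * ∑ l, u i l * v j l ≤ K

theorem IsVectorBound.le {κ : Type*} [Fintype κ] {E : κ → κ → ℝ} {K : ℝ}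
    (h : IsVectorBound E K) {ι : Type*} [Fintype ι] {u v : κ → ι → ℝ}
    (hu : ∀ i, ∑ l, u i l ^ 2 ≤ 1) (hv : ∀ i, ∑ l, v i l ^ 2 ≤ 1) :
    ∑ i, ∑ j, E i j * ∑ l, u i l * v j l ≤ K := by
  let e := (Fintype.equivFin ι).symm
  have := h _ (fun i l => u i (e l)) (fun i l => v i (e l))
    (fun i => by rw [e.sum_comp (fun l => u i l ^ 2)]; exact hu i)
    (fun i => by rw [e.sum_comp (fun l => v i l ^ 2)]; exact hv i)
  refine le_trans (le_of_eq ?_) this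
  refine Finset.sum_congr rfl fun i _ => Finset.sum_congr rfl fun j _ => ?_
  rw [e.sum_comp (fun l => u i l * v j l)]

/-- Rescaling to unit balls: a vector family shorter by a factor `s` gains that factor in the bound.
Here `c` will be `2 ^ m`, the total mass of the unnormalized sum over signs. -/
theorem IsVectorBound.scaled {κ : Type*} [Fintype κ] {E : κ → κ → ℝ} {K : ℝ}
    (h : IsVectorBound E K) {ι : Type*} [Fintype ι] {u v : κ → ι → ℝ} {c s : ℝ}
    (hc : 0 < c) (hs : 0 < s)
    (hu : ∀ i, ∑ l, u i l ^ 2 ≤ c) (hv : ∀ i, s ^ 2 * ∑ l, v i l ^ 2 ≤ c) :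
    ∑ i, ∑ j, E i j * ∑ l, u i l * v j l ≤ c * K / s := by
  have hq : √c ^ 2 = c := Real.sq_sqrt hc.le
  have hq0 : 0 < √c := Real.sqrt_pos.2 hc
  have := h.le (u := fun i l => u i l / √c) (v := fun i l => s * v i l / √c)
    (fun i => by
      simp only [div_pow, hq, ← Finset.sum_div]
      exact (div_le_one hc).2 (hu i))
    (fun i => by
      simp only [div_pow, hq, mul_pow, ← Finset.sum_div, ← Finset.mul_sum]
      exact (div_le_one hc).2 (hv i))
  have e : ∑ i, ∑ j, E i j * ∑ l, u i l / √c * (s * v j l / √c) =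
      (s / c) * ∑ i, ∑ j, E i j * ∑ l, u i l * v j l := by
    simp only [Finset.mul_sum]
    refine Finset.sum_congr rfl fun i _ => Finset.sum_congr rfl fun j _ =>
      Finset.sum_congr rfl fun l _ => ?_
    have : s / c = s / (√c * √c) := by rw [← sq, hq]
    rw [this]
    field_simp
  rw [e] at this
  rw [le_div_iff₀ hs]
  rw [div_mul_eq_mul_div, div_le_iff₀ hc] at this
  linarith

/-- Truncation at level `7`. -/
noncomputable def trunc (x : ℝ) : ℝ := if |x| ≤ 7 then x else 0

theorem abs_trunc_le (x : ℝ) : |trunc x| ≤ 7 := by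
  unfold trunc; split_ifs with h
  · exact h
  · norm_num

theorem trunc_sq_le (x : ℝ) : trunc x ^ 2 ≤ x ^ 2 := by
  unfold trunc; split_ifs with h
  · exact le_rfl
  · simpa using sq_nonneg x

theorem sub_trunc_sq_le (x : ℝ) : 49 * (x - trunc x) ^ 2 ≤ x ^ 4 := by
  unfold trunc; split_ifs with h
  · simp; positivity
  · have h7 : 49 ≤ x ^ 2 := by
      rw [← sq_abs]; nlinarith [not_le.1 h]
    nlinarith [sq_nonneg x]

/-- Inner products are correlations of Rademacher sums. Split each sum into its truncation and a
tail: two truncations form a bounded scalar problem for each `ω`, costing `7 ^ 2 * N`, while each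
term with a tail is again a vector problem, in dimension `2 ^ m`, whose tail has norm at most `1/4`
after normalization. Hence `K / 4` twice; the bound `K` must be independent of the dimension for
this. -/
theorem IsVectorBound.improve {κ : Type*} [Fintype κ] {E : κ → κ → ℝ} {K N : ℝ}
    (hN : ∀ x y : κ → Bool, ∑ i, ∑ j, E i j * boolSign (x i) * boolSign (y j) ≤ N)
    (h : IsVectorBound E K) : IsVectorBound E (49 * N + K / 2) := by
  intro m u v hu hv
  have hc : (0 : ℝ) < 2 ^ m := by positivity
  have hX : ∀ w : Fin m → ℝ, ∑ l, w l ^ 2 ≤ 1 → ∑ ω, signSum w ω ^ 2 ≤ 2 ^ m := by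
    intro w hw
    have := sum_signSum_mul w w
    simp only [← sq] at this
    rw [this]
    nlinarith
  have hY : ∀ w : Fin m → ℝ, ∑ l, w l ^ 2 ≤ 1 → ∑ ω, trunc (signSum w ω) ^ 2 ≤ 2 ^ m :=
    fun w hw => (Finset.sum_le_sum fun ω _ => trunc_sq_le _).trans (hX w hw)
  -- The truncation level 7 is chosen for this: the fourth moment gives tail mass at most `3 / 49 ≤
  -- 1 / 4 ^ 2`.
  have hZ : ∀ w : Fin m → ℝ, ∑ l, w l ^ 2 ≤ 1 →
      (4 : ℝ) ^ 2 * ∑ ω, (signSum w ω - trunc (signSum w ω)) ^ 2 ≤ 2 ^ m := by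
    intro w hw
    have h1 : 49 * ∑ ω, (signSum w ω - trunc (signSum w ω)) ^ 2 ≤ ∑ ω, signSum w ω ^ 4 := by
      rw [Finset.mul_sum]
      exact Finset.sum_le_sum fun ω _ => sub_trunc_sq_le _
    have h2 := sum_signSum_pow_four_le w
    have h3 : (∑ l, w l ^ 2) ^ 2 ≤ 1 :=
      pow_le_one₀ (Finset.sum_nonneg fun _ _ => sq_nonneg _) hw
    nlinarith
  have t1 : ∑ i, ∑ j, E i j * ∑ ω, trunc (signSum (u i) ω) * trunc (signSum (v j) ω) ≤
      2 ^ m * (49 * N) := by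
    have : ∑ i, ∑ j, E i j * ∑ ω, trunc (signSum (u i) ω) * trunc (signSum (v j) ω) =
        ∑ ω : Fin m → Bool, 49 * ∑ i, ∑ j, E i j * (trunc (signSum (u i) ω) / 7) *
          (trunc (signSum (v j) ω) / 7) := by
      simp only [Finset.mul_sum]
      rw [eq_comm, Finset.sum_comm]
      refine Finset.sum_congr rfl fun i _ => ?_
      rw [Finset.sum_comm]
      exact Finset.sum_congr rfl fun j _ => Finset.sum_congr rfl fun ω _ => by ring
    rw [this]
    have hb : ∀ x, |trunc x / 7| ≤ 1 := fun x => by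
      rw [abs_div, abs_of_pos (by norm_num : (0 : ℝ) < 7), div_le_one (by norm_num)]
      exact abs_trunc_le x
    refine (Finset.sum_le_card_nsmul _ _ (49 * N) fun ω _ => ?_).trans (by simp)
    exact mul_le_mul_of_nonneg_left (bilin_le_of_signs hN (fun i => hb _) fun j => hb _)
      (by norm_num)
  have t2 := h.scaled hc (by norm_num : (0 : ℝ) < 4) (fun i => hY _ (hu i)) (fun i => hZ _ (hv i))
  have t3 : ∑ i, ∑ j, E i j * ∑ ω, (signSum (u i) ω - trunc (signSum (u i) ω)) *
      signSum (v j) ω ≤ 2 ^ m * K / 4 := by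
    -- Here the short family is the first one, so a factor 4 is moved across the product.
    have := h.scaled (u := fun i ω => 4 * (signSum (u i) ω - trunc (signSum (u i) ω)))
      (v := fun j ω => signSum (v j) ω / 4) (s := 4) hc (by norm_num) (fun i => ?_) (fun j => ?_)
    · refine le_trans (le_of_eq ?_) this
      refine Finset.sum_congr rfl fun i _ => Finset.sum_congr rfl fun j _ => ?_
      congr 1
      exact Finset.sum_congr rfl fun ω _ => by ring
    · simpa only [mul_pow, ← Finset.mul_sum] using hZ _ (hu i)
    · simp only [div_pow, ← Finset.sum_div]
      have := hX _ (hv j)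
      linarith
  have e : 2 ^ m * ∑ i, ∑ j, E i j * ∑ l, u i l * v j l =
      (∑ i, ∑ j, E i j * ∑ ω, trunc (signSum (u i) ω) * trunc (signSum (v j) ω)) +
      (∑ i, ∑ j, E i j * ∑ ω, trunc (signSum (u i) ω) *
        (signSum (v j) ω - trunc (signSum (v j) ω))) +
      ∑ i, ∑ j, E i j * ∑ ω, (signSum (u i) ω - trunc (signSum (u i) ω)) * signSum (v j) ω := by
    simp only [← Finset.sum_add_distrib, ← mul_add]
    rw [Finset.mul_sum]
    refine Finset.sum_congr rfl fun i _ => ?_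
    rw [Finset.mul_sum]
    refine Finset.sum_congr rfl fun j _ => ?_
    rw [mul_left_comm, ← sum_signSum_mul]
    congr 1
    exact Finset.sum_congr rfl fun ω _ => by ring
  refine le_of_mul_le_mul_left ?_ hc
  rw [e]
  linarith

/-- Grothendieck's inequality. -/
theorem isVectorBound_of_signs {κ : Type*} [Fintype κ] {E : κ → κ → ℝ} {N : ℝ}
    (hN : ∀ x y : κ → Bool, ∑ i, ∑ j, E i j * boolSign (x i) * boolSign (y j) ≤ N) :
    IsVectorBound E (98 * N) := by
  have h0 : IsVectorBound E (∑ i, ∑ j, |E i j|) := by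
    intro m u v hu hv
    refine Finset.sum_le_sum fun i _ => Finset.sum_le_sum fun j _ => ?_
    have h1 : |∑ l, u i l * v j l| ≤ 1 := by
      refine abs_le_one_iff_mul_self_le_one.2 ?_
      rw [← sq]
      refine (Finset.sum_mul_sq_le_sq_mul_sq _ _ _).trans ?_
      exact mul_le_one₀ (hu i) (Finset.sum_nonneg fun _ _ => sq_nonneg _) (hv j)
    refine (le_abs_self _).trans ?_
    rw [abs_mul]
    exact mul_le_of_le_one_right (abs_nonneg _) h1
  -- The map `K ↦ 49 * N + K / 2` has fixed point `98 * N`; iterating from the crude bound halves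
  -- the distance to it each time.
  have h1 : ∀ t : ℕ, IsVectorBound E
      (98 * N + (1 / 2) ^ t * ((∑ i, ∑ j, |E i j|) - 98 * N)) := by
    intro t
    induction t with
    | zero => simpa using h0
    | succ t ih =>
      convert ih.improve hN using 1
      ring
  intro m u v hu hv
  refine ge_of_tendsto' (f := fun t : ℕ => 98 * N +
    (1 / 2 : ℝ) ^ t * ((∑ i, ∑ j, |E i j|) - 98 * N)) (x := Filter.atTop) ?_
    fun t => h1 t m u v hu hv
  simpa using ((tendsto_pow_atTop_nhds_zero_of_lt_one (by norm_num : (0 : ℝ) ≤ 1 / 2)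
    (by norm_num)).mul_const ((∑ i, ∑ j, |E i j|) - 98 * N)).const_add (98 * N)

theorem abs_boolSign (b : Bool) : |boolSign b| = 1 := by cases b <;> simp [boolSign]

/-! ### Population edge probabilities and expected degrees -/

namespace DCSBM

variable {n k : ℕ} (M : DCSBM n k)

/-- The number `B_{ab} θ_i θ_j` (`i = j` included). -/
def prob (i j : Fin n) : ℝ := M.B (M.label i) (M.label j) * M.θ i * M.θ j

theorem prob_nonneg (i j : Fin n) : 0 ≤ M.prob i j :=
  mul_nonneg (mul_nonneg (M.B_nonneg _ _) (M.θ_nonneg _)) (M.θ_nonneg _)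

theorem prob_symm (i j : Fin n) : M.prob i j = M.prob j i := by
  unfold prob
  rw [M.B_symm.apply]
  ring

theorem G_nonneg (a : Fin k) : 0 ≤ M.G a := Finset.sum_nonneg fun _ _ => M.θ_nonneg _

theorem H_nonneg (a : Fin k) : 0 ≤ M.H a :=
  Finset.sum_nonneg fun b _ => mul_nonneg (M.B_nonneg _ _) (M.G_nonneg b)

theorem f_nonneg (i : Fin n) : 0 ≤ M.f i := mul_nonneg (M.H_nonneg _) (M.θ_nonneg _)

theorem sum_prob (i : Fin n) : ∑ j, M.prob i j = M.f i := by
  unfold f H G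
  rw [Finset.sum_mul, ← Finset.sum_fiberwise Finset.univ M.label]
  refine Finset.sum_congr rfl fun b _ => ?_
  rw [Finset.mul_sum, Finset.sum_mul]
  refine Finset.sum_congr rfl fun j hj => ?_
  rw [Finset.mem_filter] at hj
  rw [prob, hj.2]
  ring

theorem fNorm_eq : M.fNorm = ∑ i, M.f i :=
  Finset.sum_congr rfl fun i _ => abs_of_nonneg (M.f_nonneg i)

theorem fNorm_nonneg : 0 ≤ M.fNorm := Finset.sum_nonneg fun _ _ => abs_nonneg _

theorem sum_sum_prob : ∑ i, ∑ j, M.prob i j = M.fNorm := by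
  simp only [sum_prob, fNorm_eq]

end DCSBM

/-! ### Concentration of the adjacency matrix -/

/-- A double sum over `Fin n` split into its off-diagonal and diagonal parts. -/
theorem sum_sum_eq_sum_lt_add_diag {n : ℕ} (g : Fin n → Fin n → ℝ) :
    ∑ i, ∑ j, g i j =
      ∑ e : {e : Fin n × Fin n // e.1 < e.2}, (g e.1.1 e.1.2 + g e.1.2 e.1.1) + ∑ i, g i i := by
  have h : ∀ q : Fin n → Fin n → ℝ, ∑ e : {e : Fin n × Fin n // e.1 < e.2}, q e.1.1 e.1.2 =
      ∑ i, ∑ j, if i < j then q i j else 0 := by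
    intro q
    rw [← Fintype.sum_prod_type' (f := fun i j : Fin n => if i < j then q i j else 0),
      ← Finset.sum_filter]
    exact (Finset.sum_subtype _ (by simp) (fun e : Fin n × Fin n => q e.1 e.2)).symm
  rw [Finset.sum_add_distrib, h g, h fun i j => g j i,
    Finset.sum_comm (f := fun i j => if i < j then g j i else 0), ← Finset.sum_add_distrib,
    ← Finset.sum_add_distrib]
  refine Finset.sum_congr rfl fun i _ => ?_
  have hd : g i i = ∑ j, if i = j then g i j else 0 := by simp
  rw [hd, ← Finset.sum_add_distrib, ← Finset.sum_add_distrib]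
  refine Finset.sum_congr rfl fun j _ => ?_
  rcases lt_trichotomy i j with h | h | h
  · simp [h, h.ne, h.not_gt]
  · simp [h]
  · simp [h, h.ne', h.not_gt]

section Bernoulli

variable {Ω : Type*} [MeasurableSpace Ω] {μ : Measure Ω} [IsProbabilityMeasure μ]
  {X : Ω → ℝ} {p : ℝ}

theorem integrable_of_zero_or_one (hm : Measurable X) (h01 : ∀ ω, X ω = 0 ∨ X ω = 1) :
    Integrable X μ := by
  refine Integrable.of_bound hm.aestronglyMeasurable 1 (Filter.Eventually.of_forall fun ω => ?_)
  rcases h01 ω with h | h <;> simp [h]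

theorem integral_of_zero_or_one {Ω : Type*} [MeasurableSpace Ω] {μ : Measure Ω} {X : Ω → ℝ}
    {p : ℝ} (hm : Measurable X) (h01 : ∀ ω, X ω = 0 ∨ X ω = 1)
    (hp : μ.real {ω | X ω = 1} = p) : ∫ ω, X ω ∂μ = p := by
  have hX : X = Set.indicator {ω | X ω = 1} 1 := by
    funext ω
    rcases h01 ω with h | h <;> simp [Set.indicator, h]
  rw [← hp, ← integral_indicator_one (measurableSet_eq_fun hm measurable_const), ← hX]

theorem exp_mul_sub_eq {Ω : Type*} {X : Ω → ℝ} {p : ℝ} (h01 : ∀ ω, X ω = 0 ∨ X ω = 1) (s : ℝ) (ω : Ω) :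
    Real.exp (s * (X ω - p)) =
      Real.exp (-(s * p)) * (1 + X ω * (Real.exp s - 1)) := by
  rcases h01 ω with h | h
  · simp [h]
  · rw [h, one_mul, add_sub_cancel, ← Real.exp_add]; ring_nf

/-- The exponent is proportional to `p`, not merely bounded as in Hoeffding's lemma; this is why
`‖f‖₁` rather than `n ^ 2` governs the deviations. -/
theorem integral_exp_mul_sub_le (hm : Measurable X) (h01 : ∀ ω, X ω = 0 ∨ X ω = 1)
    (hp : μ.real {ω | X ω = 1} = p) {s : ℝ} (hs : |s| ≤ 1) :
    ∫ ω, Real.exp (s * (X ω - p)) ∂μ ≤ Real.exp (p * s ^ 2) := by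
  have hp0 : 0 ≤ p := hp ▸ measureReal_nonneg
  simp only [exp_mul_sub_eq h01]
  rw [integral_const_mul, integral_add (integrable_const _)
    ((integrable_of_zero_or_one hm h01).mul_const _), integral_mul_const,
    integral_of_zero_or_one hm h01 hp]
  simp only [integral_const, probReal_univ, smul_eq_mul, mul_one]
  calc Real.exp (-(s * p)) * (1 + p * (Real.exp s - 1))
      ≤ Real.exp (-(s * p)) * Real.exp (p * (Real.exp s - 1)) := by
        gcongr
        linarith [Real.add_one_le_exp (p * (Real.exp s - 1))]
    _ = Real.exp (p * (Real.exp s - 1 - s)) := by rw [← Real.exp_add]; ring_nf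
    _ ≤ _ := by
        refine Real.exp_le_exp.2 (mul_le_mul_of_nonneg_left ?_ hp0)
        exact (le_abs_self _).trans (Real.abs_exp_sub_one_sub_id_le hs)

end Bernoulli

namespace DCSBM.IsAdjacency

variable {n k : ℕ} {M : DCSBM n k} {Ω : Type*} [MeasurableSpace Ω] {μ : Measure Ω}
  [IsProbabilityMeasure μ] {A : Ω → Matrix (Fin n) (Fin n) ℝ}

theorem integral_exp_sum_le (h : M.IsAdjacency μ A)
    {c : {e : Fin n × Fin n // e.1 < e.2} → ℝ} (hc : ∀ e, |c e| ≤ 2) {t : ℝ}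
    (ht0 : 0 ≤ t) (ht : t ≤ 1 / 2) :
    mgf (∑ e, fun ω => c e * (A ω e.1.1 e.1.2 - M.prob e.1.1 e.1.2)) μ t ≤
      Real.exp (2 * t ^ 2 * M.fNorm) := by
  have hind : iIndepFun (fun e ω => c e * (A ω e.1.1 e.1.2 - M.prob e.1.1 e.1.2)) μ :=
    h.indep.comp (fun e x => c e * (x - M.prob e.1.1 e.1.2)) fun e => by fun_prop
  have hmeas : ∀ e : {e : Fin n × Fin n // e.1 < e.2},
      Measurable fun ω => c e * (A ω e.1.1 e.1.2 - M.prob e.1.1 e.1.2) := fun e =>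
    ((h.measurable _ _).sub_const _).const_mul _
  rw [hind.mgf_sum hmeas]
  calc ∏ e, mgf (fun ω => c e * (A ω e.1.1 e.1.2 - M.prob e.1.1 e.1.2)) μ t
      ≤ ∏ e : {e : Fin n × Fin n // e.1 < e.2},
          Real.exp (4 * t ^ 2 * M.prob e.1.1 e.1.2) := by
        refine Finset.prod_le_prod (fun e _ => mgf_nonneg) fun e _ => ?_
        have hs : |t * c e| ≤ 1 := by
          rw [abs_mul, abs_of_nonneg ht0]
          nlinarith [hc e, abs_nonneg (c e)]
        have := integral_exp_mul_sub_le (h.measurable e.1.1 e.1.2) (fun ω => h.zero_or_one ω _ _)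
          (h.prob_one _ _ e.2.ne) hs
        simp only [mgf, ← mul_assoc]
        refine this.trans (Real.exp_le_exp.2 ?_)
        have hc2 : c e ^ 2 ≤ 4 := by
          rw [← sq_abs]; nlinarith [hc e, abs_nonneg (c e)]
        have hp := mul_nonneg (sq_nonneg t) (M.prob_nonneg e.1.1 e.1.2)
        change M.prob e.1.1 e.1.2 * (t * c e) ^ 2 ≤ _
        nlinarith [mul_le_mul_of_nonneg_left hc2 hp]
    _ = Real.exp (∑ e : {e : Fin n × Fin n // e.1 < e.2},
          4 * t ^ 2 * M.prob e.1.1 e.1.2) := (Real.exp_sum _ _).symm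
    _ ≤ _ := by
        refine Real.exp_le_exp.2 ?_
        -- By symmetry the pairs `i < j` carry at most half of `‖f‖₁`, which turns the 4 into a 2.
        rw [← M.sum_sum_prob, sum_sum_eq_sum_lt_add_diag, ← Finset.mul_sum,
          Finset.sum_add_distrib]
        simp only [fun e : {e : Fin n × Fin n // e.1 < e.2} => M.prob_symm e.1.2 e.1.1]
        have : 0 ≤ ∑ i, M.prob i i := Finset.sum_nonneg fun i _ => M.prob_nonneg i i
        nlinarith [mul_nonneg (sq_nonneg t) this]

theorem measure_sum_ge_le (h : M.IsAdjacency μ A)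
    {c : {e : Fin n × Fin n // e.1 < e.2} → ℝ} (hc : ∀ e, |c e| ≤ 2) :
    μ.real {ω | 8 * (√(n * M.fNorm) + n) ≤
      (∑ e, fun ω => c e * (A ω e.1.1 e.1.2 - M.prob e.1.1 e.1.2)) ω} ≤
      Real.exp (-2 * n) := by
  have hn : (0 : ℝ) ≤ n := n.cast_nonneg
  have hF := M.fNorm_nonneg
  obtain ⟨t, ht0, ht, hopt⟩ : ∃ t : ℝ, 0 ≤ t ∧ t ≤ 1 / 2 ∧
      -t * (8 * (√(n * M.fNorm) + n)) + 2 * t ^ 2 * M.fNorm ≤ -2 * n := by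
    -- The choice `t = √(n / ‖f‖₁)` makes `t ^ 2 * ‖f‖₁ = n`; it is capped at `1 / 2`, where the
    -- exponential moment bound stops being available.
    rcases le_or_gt M.fNorm (4 * n) with h4 | h4
    · refine ⟨1 / 2, by norm_num, le_rfl, ?_⟩
      nlinarith [Real.sqrt_nonneg (n * M.fNorm)]
    · have hF0 : 0 < M.fNorm := by linarith
      refine ⟨√(n / M.fNorm), Real.sqrt_nonneg _, ?_, ?_⟩
      · rw [Real.sqrt_le_left (by norm_num), div_le_iff₀ hF0]
        linarith
      · have h1 : √(n / M.fNorm) ^ 2 * M.fNorm = n := by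
          rw [Real.sq_sqrt (by positivity)]; field_simp
        have h2 : √(n / M.fNorm) * √(n * M.fNorm) = n := by
          rw [← Real.sqrt_mul (by positivity)]
          have : n / M.fNorm * (n * M.fNorm) = (n : ℝ) ^ 2 := by field_simp
          rw [this, Real.sqrt_sq hn]
        nlinarith [mul_nonneg (Real.sqrt_nonneg (n / M.fNorm)) hn]
  have hmeas : Measurable (∑ e : {e : Fin n × Fin n // e.1 < e.2},
      fun ω => c e * (A ω e.1.1 e.1.2 - M.prob e.1.1 e.1.2)) :=
    Finset.sum_induction _ _ (fun _ _ => Measurable.add) measurable_zero fun e _ =>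
      ((h.measurable _ _).sub_const _).const_mul _
  have hint : Integrable (fun ω => Real.exp (t *
      (∑ e : {e : Fin n × Fin n // e.1 < e.2},
        fun ω => c e * (A ω e.1.1 e.1.2 - M.prob e.1.1 e.1.2)) ω)) μ := by
    refine Integrable.of_bound (by fun_prop) (Real.exp (t * ∑ e : {e : Fin n × Fin n // e.1 < e.2},
      2 * (1 + |M.prob e.1.1 e.1.2|))) (Filter.Eventually.of_forall fun ω => ?_)
    rw [Real.norm_eq_abs, Real.abs_exp, Real.exp_le_exp]
    refine mul_le_mul_of_nonneg_left ?_ ht0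
    rw [Finset.sum_apply]
    refine Finset.sum_le_sum fun e _ => (le_abs_self _).trans ?_
    rw [abs_mul]
    refine mul_le_mul (hc e) ((abs_sub _ _).trans ?_) (abs_nonneg _) (by norm_num)
    gcongr
    rcases h.zero_or_one ω e.1.1 e.1.2 with h | h <;> simp [h]
  refine (measure_ge_le_exp_mul_mgf _ ht0 hint).trans ?_
  refine (mul_le_mul_of_nonneg_left (h.integral_exp_sum_le hc ht0 ht)
    (Real.exp_pos _).le).trans ?_
  rw [← Real.exp_add]
  exact Real.exp_le_exp.2 hopt

/-- Concentration of the adjacency matrix in the cut norm. -/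
theorem measure_exists_signs_le (h : M.IsAdjacency μ A) :
    μ.real {ω | ∃ x y : Fin n → Bool, 9 * (√(n * M.fNorm) + n) <
      ∑ i, ∑ j, (A ω i j - M.prob i j) * boolSign (x i) * boolSign (y j)} ≤
      (Real.exp 1 / 2) ^ (-2 * (n : ℤ)) := by
  -- Only entries above the diagonal are independent, so each coefficient collects both occurrences
  -- of an edge.
  let c (z : (Fin n → Bool) × (Fin n → Bool)) (e : {e : Fin n × Fin n // e.1 < e.2}) : ℝ :=
    boolSign (z.1 e.1.1) * boolSign (z.2 e.1.2) + boolSign (z.1 e.1.2) * boolSign (z.2 e.1.1)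
  have hc : ∀ z e, |c z e| ≤ 2 := fun z e => by
    refine (abs_add_le _ _).trans ?_
    simp only [abs_mul, abs_boolSign]
    norm_num
  have hsub : {ω | ∃ x y : Fin n → Bool, 9 * (√(n * M.fNorm) + n) <
      ∑ i, ∑ j, (A ω i j - M.prob i j) * boolSign (x i) * boolSign (y j)} ⊆
      ⋃ z, {ω | 8 * (√(n * M.fNorm) + n) ≤
        (∑ e, fun ω => c z e * (A ω e.1.1 e.1.2 - M.prob e.1.1 e.1.2)) ω} := by
    rintro ω ⟨x, y, hxy⟩
    refine Set.mem_iUnion.2 ⟨(x, y), ?_⟩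
    rw [sum_sum_eq_sum_lt_add_diag] at hxy
    -- The diagonal of `A - P` is `-M.prob i i`, of size at most one; it accounts for the step from
    -- 8 to 9.
    have hd : ∑ i, (A ω i i - M.prob i i) * boolSign (x i) * boolSign (y i) ≤ n := by
      have : ∀ i, (A ω i i - M.prob i i) * boolSign (x i) * boolSign (y i) ≤ 1 := by
        intro i
        refine (le_abs_self _).trans ?_
        rw [h.diag, abs_mul, abs_mul, abs_boolSign, abs_boolSign, zero_sub, abs_neg, mul_one,
          mul_one, abs_of_nonneg (M.prob_nonneg _ _)]
        exact M.prob_le_one i i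
      exact (Finset.sum_le_sum fun i _ => this i).trans (by simp)
    have he : (∑ e, fun ω => c (x, y) e * (A ω e.1.1 e.1.2 - M.prob e.1.1 e.1.2)) ω =
        ∑ e : {e : Fin n × Fin n // e.1 < e.2},
          ((A ω e.1.1 e.1.2 - M.prob e.1.1 e.1.2) * boolSign (x e.1.1) * boolSign (y e.1.2) +
          (A ω e.1.2 e.1.1 - M.prob e.1.2 e.1.1) * boolSign (x e.1.2) * boolSign (y e.1.1)) := by
      rw [Finset.sum_apply]
      refine Finset.sum_congr rfl fun e _ => ?_
      rw [M.prob_symm e.1.2, (h.symm ω).apply e.1.1 e.1.2]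
      simp only [c]
      ring
    rw [Set.mem_ofPred_eq, he]
    have := Real.sqrt_nonneg (n * M.fNorm)
    linarith
  refine (measureReal_mono hsub).trans ((measureReal_iUnion_fintype_le _).trans ?_)
  refine (Finset.sum_le_card_nsmul _ _ _ fun z _ => h.measure_sum_ge_le (hc z)).trans ?_
  simp only [Finset.card_univ, Fintype.card_prod, Fintype.card_pi, Fintype.card_bool,
    Finset.prod_const, Fintype.card_fin, nsmul_eq_mul, Nat.cast_mul, Nat.cast_pow, Nat.cast_ofNat]
  -- The union bound totals `4 ^ n * exp (-2 n) = (e / 2) ^ (-2 n)`.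
  refine le_of_eq ?_
  have : (-2 * (n : ℤ)) = -((2 * n : ℕ) : ℤ) := by push_cast; ring
  rw [this, zpow_neg, zpow_natCast, div_pow, inv_div, ← Real.exp_nat_mul, neg_mul, Real.exp_neg]
  push_cast
  rw [mul_one, div_eq_mul_inv, pow_mul, ← mul_pow]
  norm_num

/-- Markov's inequality: the expected total degree is `‖f‖₁` less the diagonal probabilities. -/
theorem measure_sum_gt_le (h : M.IsAdjacency μ A) (hF : 0 < M.fNorm) :
    μ.real {ω | 100 * M.fNorm < ∑ i, ∑ j, A ω i j} ≤ 0.01 := by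
  have h0 : ∀ ω i j, 0 ≤ A ω i j := fun ω i j => by
    rcases h.zero_or_one ω i j with h | h <;> simp [h]
  have hi : ∀ i j, Integrable (fun ω => A ω i j) μ := fun i j =>
    integrable_of_zero_or_one (h.measurable i j) fun ω => h.zero_or_one ω i j
  have hE : ∫ ω, ∑ i, ∑ j, A ω i j ∂μ ≤ M.fNorm := by
    rw [integral_finsetSum _ fun i _ => integrable_finsetSum _ fun j _ => hi i j,
      ← M.sum_sum_prob]
    refine Finset.sum_le_sum fun i _ => ?_
    rw [integral_finsetSum _ fun j _ => hi i j]
    refine Finset.sum_le_sum fun j _ => ?_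
    rcases eq_or_ne i j with rfl | hij
    · simpa [h.diag] using M.prob_nonneg i i
    · exact (integral_of_zero_or_one (h.measurable i j) (fun ω => h.zero_or_one ω i j)
        (h.prob_one i j hij)).le
  have hM := mul_meas_ge_le_integral_of_nonneg (μ := μ) (f := fun ω => ∑ i, ∑ j, A ω i j)
    (Filter.Eventually.of_forall fun ω => Finset.sum_nonneg fun i _ => Finset.sum_nonneg
      fun j _ => h0 ω i j)
    (integrable_finsetSum _ fun i _ => integrable_finsetSum _ fun j _ => hi i j)
    (100 * M.fNorm)
  have hs : μ.real {ω | 100 * M.fNorm < ∑ i, ∑ j, A ω i j} ≤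
      μ.real {ω | 100 * M.fNorm ≤ ∑ i, ∑ j, A ω i j} := measureReal_mono fun ω hω => by
    rw [Set.mem_ofPred_eq] at hω ⊢
    exact hω.le
  refine hs.trans ?_
  have := hM.trans hE
  refine le_of_mul_le_mul_left ?_ hF
  linarith

end DCSBM.IsAdjacency

/-! ### Deterministic analysis of optimal solutions -/

theorem boolSign_not (b : Bool) : boolSign (!b) = -boolSign b := by cases b <;> simp [boolSign]

/-- Test against the signs of the row sums and the all-ones vector. For `E = A - P` the row sums are
`d - f`. -/
theorem sum_abs_rowSum_le {κ : Type*} [Fintype κ] {E : κ → κ → ℝ} {N : ℝ}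
    (hN : ∀ x y : κ → Bool, ∑ i, ∑ j, E i j * boolSign (x i) * boolSign (y j) ≤ N) :
    ∑ i, |∑ j, E i j| ≤ N := by
  refine le_trans (le_of_eq ?_) (hN (fun i => decide (0 ≤ ∑ j, E i j)) fun _ => true)
  refine Finset.sum_congr rfl fun i _ => ?_
  simp only [mul_assoc, ← Finset.sum_mul]
  by_cases h : 0 ≤ ∑ j, E i j
  · simp [boolSign, h, abs_of_nonneg h]
  · simp [boolSign, h, abs_of_neg (not_le.1 h)]

theorem mul_transpose_nonneg {n r p : ℕ} {U : Matrix (Fin n) (Fin r) ℝ}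
    (hU : U ∈ cpFeasible n r p) (i j : Fin n) : 0 ≤ (U * U.transpose) i j := by
  simp only [Matrix.mul_apply, Matrix.transpose_apply]
  exact Finset.sum_nonneg fun l _ => mul_nonneg (hU.2.2 i l) (hU.2.2 j l)

theorem mul_transpose_le_one {n r p : ℕ} {U : Matrix (Fin n) (Fin r) ℝ}
    (hU : U ∈ cpFeasible n r p) (i j : Fin n) : (U * U.transpose) i j ≤ 1 := by
  simp only [Matrix.mul_apply, Matrix.transpose_apply]
  have h : ∀ l, U i l * U j l ≤ (U i l ^ 2 + U j l ^ 2) / 2 := fun l => by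
    nlinarith [sq_nonneg (U i l - U j l)]
  refine (Finset.sum_le_sum fun l _ => h l).trans ?_
  rw [← Finset.sum_div, Finset.sum_add_distrib, hU.1, hU.1]
  norm_num

namespace DCSBM

variable {n k : ℕ} {M : DCSBM n k}

/-- Division by zero yields `0`, so `H c = 0` would put `0` on the right of a strict inequality
whose left side is nonnegative; `k ≥ 2` supplies a pair of communities. -/
theorem DensityGap.H_pos (hk : 2 ≤ k) (h : M.DensityGap) (c : Fin k) : 0 < M.H c := by
  refine lt_of_le_of_ne (M.H_nonneg c) fun h0 => ?_
  have h1 := h ⟨0, by omega⟩ ⟨1, by omega⟩ c (by simp [Fin.lt_def])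
  rw [← h0] at h1
  have : 0 ≤ M.B ⟨0, by omega⟩ ⟨1, by omega⟩ / (M.H ⟨0, by omega⟩ * M.H ⟨1, by omega⟩) :=
    div_nonneg (M.B_nonneg _ _) (mul_nonneg (M.H_nonneg _) (M.H_nonneg _))
  norm_num at h1
  linarith

theorem DensityGap.fNorm_pos (hk : 2 ≤ k) (h : M.DensityGap) : 0 < M.fNorm := by
  refine lt_of_le_of_ne M.fNorm_nonneg fun h0 => ?_
  rw [M.fNorm_eq, eq_comm, Finset.sum_eq_zero_iff_of_nonneg fun i _ => M.f_nonneg i] at h0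
  have hθ : ∀ i, M.θ i = 0 := fun i =>
    (mul_eq_zero.1 (h0 i (Finset.mem_univ i))).resolve_left (h.H_pos hk _).ne'
  have := h.H_pos hk ⟨0, by omega⟩
  simp [H, G, hθ] at this

variable {δ lam : ℝ}

theorem InGap.pos (hk : 2 ≤ k) (hH : ∀ a, 0 < M.H a) (hδ : 0 < δ) (h : M.InGap lam δ) :
    0 < lam := by
  refine lt_trans ?_ (h.1 ⟨0, by omega⟩ ⟨1, by omega⟩ (by simp [Fin.lt_def]))
  have := M.B_nonneg ⟨0, by omega⟩ ⟨1, by omega⟩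
  exact div_pos (by linarith) (mul_pos (hH _) (hH _))

theorem InGap.offDiag (hH : ∀ a, 0 < M.H a) (h : M.InGap lam δ) {a b : Fin k} (hab : a ≠ b) :
    M.B a b + δ ≤ lam * (M.H a * M.H b) := by
  rcases lt_or_gt_of_ne hab with hl | hl
  · exact ((div_lt_iff₀ (mul_pos (hH _) (hH _))).1 (h.1 a b hl)).le
  · have := ((div_lt_iff₀ (mul_pos (hH _) (hH _))).1 (h.1 b a hl)).le
    rwa [M.B_symm.apply, mul_comm (M.H b)] at this

theorem InGap.diag (hH : ∀ a, 0 < M.H a) (h : M.InGap lam δ) (a : Fin k) :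
    lam * (M.H a * M.H a) ≤ M.B a a - δ := by
  rw [← sq]
  exact ((lt_div_iff₀ (pow_pos (hH a) 2)).1 (h.2 a)).le

theorem InGap.mul_fNorm_le (hk : 2 ≤ k) (hH : ∀ a, 0 < M.H a) (hδ : 0 < δ)
    (h : M.InGap lam δ) :
    lam * M.fNorm ≤ ⨆ a : Fin k, M.B a a / M.H a ^ 2 * M.fNorm := by
  let a : Fin k := ⟨0, by omega⟩
  refine le_trans ?_ (le_ciSup (f := fun a => M.B a a / M.H a ^ 2 * M.fNorm)
    (Set.finite_range _).bddAbove a)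
  refine mul_le_mul_of_nonneg_right ((h.2 a).le.trans ?_) M.fNorm_nonneg
  have := hH a
  gcongr
  linarith

theorem assignment_mul_transpose {r : ℕ} (hr : k ≤ r) (i j : Fin n) :
    (M.assignment r * (M.assignment r).transpose) i j =
      if M.label i = M.label j then 1 else 0 := by
  simp only [Matrix.mul_apply, Matrix.transpose_apply, assignment, Matrix.of_apply]
  rw [Finset.sum_eq_single (Fin.castLE hr (M.label i))]
  · simp [Fin.ext_iff, eq_comm]
  · intro l _ hl
    rw [if_neg, zero_mul]
    intro h
    exact hl (Fin.ext h.symm)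
  · simp

theorem assignment_mem {r p : ℕ} (hr : k ≤ r) (hp : 1 ≤ p) :
    M.assignment r ∈ cpFeasible n r p := by
  refine ⟨fun i => ?_, fun i => ?_, fun i l => ?_⟩
  · have := M.assignment_mul_transpose hr i i
    simpa [Matrix.mul_apply, sq] using this
  · refine le_trans ?_ hp
    rw [Set.ncard_le_one]
    intro a ha b hb
    simp only [assignment, Matrix.of_apply, Set.mem_ofPred_eq, ne_eq, ite_eq_right_iff,
      one_ne_zero, imp_false, not_not] at ha hb
    exact Fin.ext (ha.symm.trans hb)
  · simp only [assignment, Matrix.of_apply]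
    split_ifs <;> norm_num

/-- The population objective separates any feasible point from the true assignment. -/
theorem InGap.mul_abs_le (hH : ∀ a, 0 < M.H a) (h : M.InGap lam δ) {r p : ℕ} (hr : k ≤ r)
    {U : Matrix (Fin n) (Fin r) ℝ} (hU : U ∈ cpFeasible n r p) (i j : Fin n) :
    δ * (|(U * U.transpose - M.assignment r * (M.assignment r).transpose) i j| * M.θ i * M.θ j) ≤
      -(M.prob i j - lam * (M.f i * M.f j)) *
        (U * U.transpose - M.assignment r * (M.assignment r).transpose) i j := by
  have h0 := mul_transpose_nonneg hU i j
  have h1 := mul_transpose_le_one hU i j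
  have hθ := mul_nonneg (M.θ_nonneg i) (M.θ_nonneg j)
  rw [Matrix.sub_apply, M.assignment_mul_transpose hr]
  set X := (U * U.transpose) i j
  unfold prob f
  split_ifs with hl
  · rw [hl, abs_of_nonpos (by linarith)]
    have := h.diag hH (M.label j)
    nlinarith [mul_nonneg (mul_nonneg hθ (by linarith : 0 ≤ 1 - X)) (sub_nonneg.2 this)]
  · rw [sub_zero, abs_of_nonneg h0]
    have := h.offDiag hH hl
    nlinarith [mul_nonneg (mul_nonneg hθ h0) (sub_nonneg.2 this)]

/-- The only use of optimality: comparison with the true assignment. -/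
theorem sum_mul_sub_nonneg {A : Matrix (Fin n) (Fin n) ℝ} {r p : ℕ} (hr : k ≤ r) (hp : 1 ≤ p)
    {U : Matrix (Fin n) (Fin r) ℝ} (hU : IsCPOptimal A lam p U) :
    0 ≤ ∑ i, ∑ j, (A i j - lam * (degreeVec A i * degreeVec A j)) *
      (U * U.transpose - M.assignment r * (M.assignment r).transpose) i j := by
  have h := hU.2 (M.assignment_mem hr hp)
  simp only [Set.mem_ofPred_eq, cpObjective] at h
  rw [← sub_nonneg] at h
  refine h.trans (le_of_eq ?_)
  simp only [← Finset.sum_sub_distrib]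
  refine Finset.sum_congr rfl fun i _ => Finset.sum_congr rfl fun j _ => ?_
  simp only [costMatrix, Matrix.neg_apply, Matrix.sub_apply, Matrix.smul_apply,
    Matrix.vecMulVec_apply, smul_eq_mul]
  ring

/-- The error bound on the event that the adjacency matrix is close to its expectation. -/
theorem weightedNorm_le_of_signs (hk : 2 ≤ k) (hH : ∀ a, 0 < M.H a) (hδ : 0 < δ)
    (h : M.InGap lam δ) {A : Matrix (Fin n) (Fin n) ℝ} (hA : ∀ i j, 0 ≤ A i j) {N : ℝ}
    (hN : ∀ x y : Fin n → Bool,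
      ∑ i, ∑ j, (A i j - M.prob i j) * boolSign (x i) * boolSign (y j) ≤ N)
    (hsum : ∑ i, ∑ j, A i j ≤ 100 * M.fNorm)
    {r p : ℕ} (hr : k ≤ r) (hp : 1 ≤ p)
    {U : Matrix (Fin n) (Fin r) ℝ} (hU : IsCPOptimal A lam p U) :
    M.weightedNorm (U * U.transpose - M.assignment r * (M.assignment r).transpose) ≤
      196 / δ * (1 + ⨆ a : Fin k, M.B a a / M.H a ^ 2 * M.fNorm) * N := by
  have hopt := M.sum_mul_sub_nonneg hr hp hU
  have hlam := h.pos hk hH hδ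
  have hΦ := M.assignment_mem (p := p) hr hp
  have hsep : δ * M.weightedNorm
      (U * U.transpose - M.assignment r * (M.assignment r).transpose) ≤
      ∑ i, ∑ j, -(M.prob i j - lam * (M.f i * M.f j)) *
        (U * U.transpose - M.assignment r * (M.assignment r).transpose) i j := by
    simp only [weightedNorm, Finset.mul_sum]
    exact Finset.sum_le_sum fun i _ => Finset.sum_le_sum fun j _ => h.mul_abs_le hH hr hU.1 i j
  have hGU : ∑ i, ∑ j, (A i j - M.prob i j) * (U * U.transpose) i j ≤ 98 * N := by
    simp only [Matrix.mul_apply, Matrix.transpose_apply]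
    exact isVectorBound_of_signs hN r U U (fun i => (hU.1.1 i).le) fun i => (hU.1.1 i).le
  have hGΦ : ∑ i, ∑ j, -(A i j - M.prob i j) *
      (M.assignment r * (M.assignment r).transpose) i j ≤ 98 * N := by
    simp only [Matrix.mul_apply, Matrix.transpose_apply]
    refine isVectorBound_of_signs (fun x y => ?_) r _ _ (fun i => (hΦ.1 i).le)
      fun i => (hΦ.1 i).le
    -- Flipping one sign vector shows that `-(A - P)` obeys the same bound.
    refine le_trans (le_of_eq ?_) (hN (fun i => !x i) y)
    simp only [boolSign_not, neg_mul, mul_neg]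
  have hD : ∀ i j, |(U * U.transpose - M.assignment r * (M.assignment r).transpose) i j| ≤ 1 := by
    intro i j
    rw [Matrix.sub_apply, abs_le]
    have := mul_transpose_nonneg hU.1 i j
    have := mul_transpose_le_one hU.1 i j
    have := mul_transpose_nonneg hΦ i j
    have := mul_transpose_le_one hΦ i j
    constructor <;> linarith
  have hd0 : ∀ i, 0 ≤ degreeVec A i := fun i => Finset.sum_nonneg fun j _ => hA i j
  have hdf : ∑ i, |degreeVec A i - M.f i| ≤ N := by
    refine le_trans (le_of_eq ?_) (sum_abs_rowSum_le hN)
    simp only [Finset.sum_sub_distrib, sum_prob, degreeVec]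
  have hF := M.fNorm_nonneg
  have hN0 : 0 ≤ N := (Finset.sum_nonneg fun _ _ => abs_nonneg _).trans hdf
  have hdeg : ∑ i, ∑ j, -(degreeVec A i * degreeVec A j - M.f i * M.f j) *
      (U * U.transpose - M.assignment r * (M.assignment r).transpose) i j ≤
      101 * M.fNorm * N := by
    calc _ ≤ ∑ i, ∑ j, (|degreeVec A i - M.f i| * degreeVec A j +
            M.f i * |degreeVec A j - M.f j|) := by
          refine Finset.sum_le_sum fun i _ => Finset.sum_le_sum fun j _ => ?_
          refine (le_abs_self _).trans ?_
          rw [abs_mul, abs_neg]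
          refine (mul_le_of_le_one_right (abs_nonneg _) (hD i j)).trans ?_
          have e : degreeVec A i * degreeVec A j - M.f i * M.f j =
            (degreeVec A i - M.f i) * degreeVec A j + M.f i * (degreeVec A j - M.f j) := by ring
          rw [e]
          refine (abs_add_le _ _).trans (le_of_eq ?_)
          rw [abs_mul, abs_mul, abs_of_nonneg (hd0 j), abs_of_nonneg (M.f_nonneg i)]
      _ = (∑ i, |degreeVec A i - M.f i|) * (∑ j, degreeVec A j + M.fNorm) := by
          simp only [Finset.sum_add_distrib, ← Finset.mul_sum, ← Finset.sum_mul, ← M.fNorm_eq]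
          ring
      _ ≤ N * (101 * M.fNorm) := by
          refine mul_le_mul hdf ?_ (add_nonneg (Finset.sum_nonneg fun j _ => hd0 j) hF) hN0
          have : ∑ j, degreeVec A j ≤ 100 * M.fNorm := hsum
          linarith
      _ = _ := by ring
  have hdec : ∑ i, ∑ j, -(M.prob i j - lam * (M.f i * M.f j)) *
        (U * U.transpose - M.assignment r * (M.assignment r).transpose) i j =
      ∑ i, ∑ j, (A i j - M.prob i j) * (U * U.transpose) i j +
      ∑ i, ∑ j, -(A i j - M.prob i j) * (M.assignment r * (M.assignment r).transpose) i j +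
      lam * ∑ i, ∑ j, -(degreeVec A i * degreeVec A j - M.f i * M.f j) *
        (U * U.transpose - M.assignment r * (M.assignment r).transpose) i j -
      ∑ i, ∑ j, (A i j - lam * (degreeVec A i * degreeVec A j)) *
        (U * U.transpose - M.assignment r * (M.assignment r).transpose) i j := by
    simp only [Finset.mul_sum, ← Finset.sum_add_distrib, ← Finset.sum_sub_distrib]
    refine Finset.sum_congr rfl fun i _ => Finset.sum_congr rfl fun j _ => ?_
    rw [Matrix.sub_apply]
    ring
  have hsup := h.mul_fNorm_le hk hH hδ
  have hlF : 0 ≤ lam * M.fNorm := mul_nonneg hlam.le hF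
  rw [div_mul_eq_mul_div, div_mul_eq_mul_div, le_div_iff₀ hδ]
  have hdeg' := mul_le_mul_of_nonneg_left hdeg hlam.le
  have hsup' := mul_le_mul_of_nonneg_right hsup hN0
  have := mul_nonneg hlF hN0
  -- The total is `(98 + 98 + 101 * lam * ‖f‖₁) * N`, and `101 ≤ 196`.
  linarith

end DCSBM

/-! ### Combining the two exceptional events -/

theorem mainTheorem5 :
    ∃ C₀ : ℝ, 0 < C₀ ∧
      ∀ (n k r p : ℕ), 2 ≤ k → k ≤ r → 1 ≤ p → p ≤ r →
      ∀ (M : DCSBM n k), M.DensityGap →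
      ∀ (δ lam : ℝ), 0 < δ → M.InGap lam δ →
      ∀ {Ω : Type*} [MeasurableSpace Ω] (μ : Measure Ω) [IsProbabilityMeasure μ]
        (A : Ω → Matrix (Fin n) (Fin n) ℝ), M.IsAdjacency μ A →
        0.99 - 2 * (Real.exp 1 / 2) ^ (-2 * (n : ℤ)) ≤
          μ.real {ω | ∀ U : Matrix (Fin n) (Fin r) ℝ, IsCPOptimal (A ω) lam p U →
            M.weightedNorm (U * U.transpose - M.assignment r * (M.assignment r).transpose) ≤
              C₀ / δ * (1 + ⨆ a : Fin k, M.B a a / M.H a ^ 2 * M.fNorm) *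
                (√(n * M.fNorm) + n)} := by
  -- `1764 = 196 * 9`, from the deterministic bound and the cut-norm deviation.
  refine ⟨1764, by norm_num, ?_⟩
  intro n k r p hk hr hp _ M hgap δ lam hδ hlam Ω _ μ _ A hA
  have h1 := hA.measure_exists_signs_le
  have h2 := hA.measure_sum_gt_le (hgap.fNorm_pos hk)
  set Bad₁ := {ω | ∃ x y : Fin n → Bool, 9 * (√(n * M.fNorm) + n) <
      ∑ i, ∑ j, (A ω i j - M.prob i j) * boolSign (x i) * boolSign (y j)} with hB₁
  set Bad₂ := {ω | 100 * M.fNorm < ∑ i, ∑ j, A ω i j} with hB₂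
  set Good := {ω | ∀ U : Matrix (Fin n) (Fin r) ℝ, IsCPOptimal (A ω) lam p U →
            M.weightedNorm (U * U.transpose - M.assignment r * (M.assignment r).transpose) ≤
              1764 / δ * (1 + ⨆ a : Fin k, M.B a a / M.H a ^ 2 * M.fNorm) *
                (√(n * M.fNorm) + n)}
  -- Covering the whole space needs only subadditivity, so measurability of `Good` never arises.
  have hcover : (Set.univ : Set Ω) ⊆ Good ∪ (Bad₁ ∪ Bad₂) := by
    intro ω _
    by_contra hω
    simp only [Set.mem_union, not_or] at hω
    obtain ⟨hg, hb₁, hb₂⟩ := hω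
    refine hg fun U hU => ?_
    simp only [hB₁, hB₂, Set.mem_ofPred_eq, not_exists, not_lt] at hb₁ hb₂
    have h0 : ∀ i j, 0 ≤ A ω i j := fun i j => by
      rcases hA.zero_or_one ω i j with h | h <;> simp [h]
    refine (DCSBM.weightedNorm_le_of_signs hk (hgap.H_pos hk) hδ hlam h0 hb₁ hb₂ hr hp
      hU).trans (le_of_eq ?_)
    ring
  have h3 := measureReal_mono (μ := μ) hcover
  rw [probReal_univ] at h3
  have h4 := measureReal_union_le (μ := μ) Good (Bad₁ ∪ Bad₂)
  have h5 := measureReal_union_le (μ := μ) Bad₁ Bad₂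
  have h6 : 0 ≤ (Real.exp 1 / 2) ^ (-2 * (n : ℤ)) := by positivity
  generalize (Real.exp 1 / 2) ^ (-2 * (n : ℤ)) = q at h1 h6 ⊢
  linarith
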